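/- Let $k=\mathbb F_q(T)$ and let $K/k$ be a Kummer extension of exponent $n$, where $n\mid q-1$; that is, $K/k$ is a finite abelian extension whose Galois group has exponent $n$. Let $\mathcal O_K$ be the integral closure of $\mathbb F_q[T]$ in $K$, so that the finite primes $\mathfrak p\nmid\infty$ of $K$ are the nonzero primes of $\mathcal O_K$, and let $\mathfrak p\mid\infty$ denote the primes of $K$ above the infinite prime of $k$ (the one with uniformizer $1/T$). Let $k_\infty$ be the completion of $k$ at its infinite prime, $K_{\mathfrak p}$ the completion of $K$ at $\mathfrak p$, $U_{\mathfrak p}$ the group of units of $K_{\mathfrak p}$ for $\mathfrak p\nmid\infty$, and $J_K$ the idèle group of $K$. Put $$\Delta=\Big\{(\alpha_{\mathfrak p})\in\prod_{\mathfrak p\mid\infty}K_{\mathfrak p}^*\ \Big|\ \prod_{\mathfrak p\mid\infty}\operatorname{N}_{K_{\mathfrak p}/k_\infty}(\alpha_{\mathfrak p})\in k_\infty^{*n}\Big\},\qquad J_K^{(+)}=\{\vec\alpha\in J_K\mid(\alpha_{\mathfrak p})_{\mathfrak p\mid\infty}\in\Delta\},\qquad K^{(+)}=K^*\cap J_K^{(+)}.$$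 Let $I_K$ be the group of fractional ideals of $\mathcal O_K$ and $P_K^{(+)}=\{\langle\beta\rangle\mid\beta\in K^{(+)}\}$ the subgroup of principal ideals generated by elements of $K^{(+)}$. Then there are group isomorphisms $$\frac{J_K}{K^*\big(\Delta\times\prod_{\mathfrak p\nmid\infty}U_{\mathfrak p}\big)}\;\cong\;\frac{J_K^{(+)}}{K^{(+)}\big(\Delta\times\prod_{\mathfrak p\nmid\infty}U_{\mathfrak p}\big)}\;\cong\;\frac{I_K}{P_K^{(+)}}=:Cl(\mathcal O_K)^{(+)},$$ namely the natural ones: the inverse of the first is induced by the inclusion $J_K^{(+)}\subseteq J_K$, and the second is induced by $\vec\alpha\mapsto\prod_{\mathfrak p\nmid\infty}\mathfrak p^{v_{\mathfrak p}(\alpha_{\mathfrak p})}$. -/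

import Mathlib

open scoped Polynomial nonZeroDivisors

noncomputable section

namespace KummerIdeles

open IsDedekindDomain

variable (F K : Type*) [Field F] [DecidableEq (RatFunc F)] [Field K] [Algebra (RatFunc F) K]

/-! ### Infinite primes

`k = RatFunc F` is the rational function field `F(T)`. Its infinite prime is given by the valuation
`RatFunc.inftyValuation F` (uniformizer `1 / T`), with completion `k_∞ = RatFunc.CompletionAtInfty F`.
-/

/-- The (discrete) valuation ring of the infinite prime of `F(T)`. -/
abbrev InftyRing : ValuationSubring (RatFunc F) := (RatFunc.inftyValuation F).valuationSubring

instance : IsDiscreteValuationRing (InftyRing F) := inferInstance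

/-- The integral closure in `K` of the valuation ring of the infinite prime of `F(T)`.
It is a semilocal Dedekind domain whose nonzero primes are the primes of `K` above infinity. -/
abbrev InftyIntegers : Subalgebra (InftyRing F) K := integralClosure (InftyRing F) K

variable [FiniteDimensional (RatFunc F) K]

instance : IsFractionRing (InftyIntegers F K) K :=
  integralClosure.isFractionRing_of_finite_extension (RatFunc F) K

variable [Algebra.IsSeparable (RatFunc F) K]

instance : IsDedekindDomain (InftyIntegers F K) :=
  IsIntegralClosure.isDedekindDomain (InftyRing F) (RatFunc F) K _

/-- The infinite primes of `K`, i.e. the primes above the infinite prime of `F(T)`. The completion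
`K_𝔭` at such a prime `w` is `w.adicCompletion K`. -/
abbrev InftyPrime := HeightOneSpectrum (InftyIntegers F K)

variable {F K}

theorem InftyPrime.under_eq (w : InftyPrime F K) :
    w.asIdeal.under (InftyRing F) = IsLocalRing.maximalIdeal (InftyRing F) :=
  IsLocalRing.eq_maximalIdeal <| (HeightOneSpectrum.under (InftyRing F) w).isPrime.isMaximal
    (HeightOneSpectrum.under (InftyRing F) w).ne_bot

instance : Finite (InftyPrime F K) := by
  let m := IsLocalRing.maximalIdeal (InftyRing F)
  have : Finite (m.primesOver (InftyIntegers F K)) :=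
    IsDedekindDomain.primesOver_finite m (B := InftyIntegers F K)
  refine Finite.of_injective (β := m.primesOver (InftyIntegers F K))
    (fun w => ⟨w.asIdeal, w.isPrime, ⟨w.under_eq.symm⟩⟩) fun w w' h => ?_
  exact HeightOneSpectrum.ext (congrArg Subtype.val h)

instance : Fintype (InftyPrime F K) := Fintype.ofFinite _

theorem InftyPrime.valuation_le_one (w : InftyPrime F K) (x : RatFunc F)
    (hx : RatFunc.inftyValuation F x ≤ 1) : w.valuation K (algebraMap (RatFunc F) K x) ≤ 1 :=
  HeightOneSpectrum.valuation_le_one w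
    (algebraMap (InftyRing F) (InftyIntegers F K) ⟨x, hx⟩)

theorem InftyPrime.valuation_X_inv_lt_one (w : InftyPrime F K) :
    w.valuation K (algebraMap (RatFunc F) K (1 / RatFunc.X)) < 1 := by
  have hX : RatFunc.inftyValuation F (1 / RatFunc.X) < 1 := by
    rw [RatFunc.inftyValuation.X_inv, ← WithZero.exp_zero, WithZero.exp_lt_exp]; norm_num
  refine (w.valuation_lt_one_iff_mem (K := K)
    (algebraMap (InftyRing F) (InftyIntegers F K) ⟨_, hX.le⟩)).mpr ?_
  change _ ∈ w.asIdeal.under (InftyRing F)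
  rw [w.under_eq]
  exact (Valuation.mem_maximalIdeal_iff ..).2 hX

/-- The embedding `k → K → K_𝔭` is continuous for the topology of the infinite prime on `k`. -/
theorem InftyPrime.continuous_embedding (w : InftyPrime F K) :
    letI := RatFunc.inftyValued F
    Continuous ((algebraMap K (w.adicCompletion K)).comp (algebraMap (RatFunc F) K)) := by
  let := RatFunc.inftyValued F
  refine continuous_of_continuousAt_zero _ ?_
  rw [ContinuousAt, map_zero]
  intro s hs
  obtain ⟨γ, hγ⟩ := Valued.mem_nhds_zero.1 hs
  refine Valued.mem_nhds_zero.2 ?_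
  obtain ⟨c, hc⟩ : ∃ c : RatFunc F, c = 1 / RatFunc.X := ⟨_, rfl⟩
  have hc0 : c ≠ 0 := by simp [hc, RatFunc.X_ne_zero]
  have hc1 := w.valuation_X_inv_lt_one
  rw [← hc] at hc1
  obtain ⟨N, hN⟩ := exists_pow_lt₀ hc1
    (Units.mk0 (MonoidWithZeroHom.ValueGroup₀.embedding γ.1) (by simp))
  refine ⟨Units.mk0 ((RatFunc.inftyValued F).v.restrict (c ^ N)) (by simp [hc0]),
    fun x hx => hγ ?_⟩
  have hx' : RatFunc.inftyValuation F x < RatFunc.inftyValuation F (c ^ N) :=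
    (Valuation.restrict_lt_iff _).1 hx
  rw [Set.mem_ofPred_eq, Valuation.restrict_lt_iff_lt_embedding]
  refine lt_of_le_of_lt ?_ hN
  have key := w.valuation_le_one (x / c ^ N) (by
    rw [map_div₀]
    exact div_le_one_of_le₀ hx'.le zero_le)
  rw [map_div₀, map_div₀, map_pow, map_pow, div_le_one₀ (by
    apply pow_pos; simp [zero_lt_iff, hc0])] at key
  exact (w.valuedAdicCompletion_eq_valuation' _).trans_le key

section Completion

open scoped RatFunc.CompletionAtInfty

/-- The canonical embedding `k_∞ → K_𝔭` for an infinite prime `𝔭` of `K`: the continuous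
extension of `k → K → K_𝔭`. -/
def InftyPrime.completionMap (w : InftyPrime F K) :
    RatFunc.CompletionAtInfty F →+* w.adicCompletion K :=
  letI := RatFunc.inftyValued F
  UniformSpace.Completion.extensionHom
    ((algebraMap K (w.adicCompletion K)).comp (algebraMap (RatFunc F) K))
    w.continuous_embedding

theorem InftyPrime.completionMap_algebraMap (w : InftyPrime F K) (x : RatFunc F) :
    w.completionMap (algebraMap (RatFunc F) (RatFunc.CompletionAtInfty F) x) =
      algebraMap K (w.adicCompletion K) (algebraMap (RatFunc F) K x) := by
  let := RatFunc.inftyValued F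
  exact UniformSpace.Completion.extensionHom_coe _ w.continuous_embedding x

theorem InftyPrime.continuous_completionMap (w : InftyPrime F K) : Continuous w.completionMap :=
  let := RatFunc.inftyValued F
  UniformSpace.Completion.continuous_extension

end Completion

/-- `K_𝔭` as a `k_∞`-algebra. -/
instance (w : InftyPrime F K) : Algebra (RatFunc.CompletionAtInfty F) (w.adicCompletion K) :=
  w.completionMap.toAlgebra

variable (F K)

/-- The group `∏_{𝔭 ∣ ∞} K_𝔭^*`. -/
abbrev InftyIdeles := ∀ w : InftyPrime F K, (w.adicCompletion K)ˣ

/-- The homomorphism `∏_{𝔭 ∣ ∞} K_𝔭^* → k_∞^*`, `(α_𝔭) ↦ ∏_{𝔭 ∣ ∞} N_{K_𝔭 / k_∞} α_𝔭`,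
with the norms of the finite extensions `K_𝔭 / k_∞`. -/
def inftyNorm : InftyIdeles F K →* (RatFunc.CompletionAtInfty F)ˣ where
  toFun α := ∏ w : InftyPrime F K,
    Units.map (Algebra.norm (RatFunc.CompletionAtInfty F) (S := w.adicCompletion K)) (α w)
  map_one' := by simp
  map_mul' α β := by simp [Finset.prod_mul_distrib]

/-- The group `Δ` of all `(α_𝔭) ∈ ∏_{𝔭 ∣ ∞} K_𝔭^*` such that `∏_{𝔭 ∣ ∞} N_{K_𝔭 / k_∞} α_𝔭` is an
`n`-th power in `k_∞^*`. -/
def Delta (n : ℕ) : Subgroup (InftyIdeles F K) :=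
  (powMonoidHom n : (RatFunc.CompletionAtInfty F)ˣ →* (RatFunc.CompletionAtInfty F)ˣ).range.comap
    (inftyNorm F K)

/-! ### Idèles -/

variable [Algebra F[X] K] [IsScalarTower F[X] (RatFunc F) K]

/-- `𝒪_K`, the integral closure of `F[T]` in `K`; its nonzero primes are the finite primes
of `K`. -/
local notation "OK" => FunctionField.ringOfIntegers F K

/-- The idèle group `J_K`: the product of `∏_{𝔭 ∣ ∞} K_𝔭^*` and the restricted product of the
`K_𝔭^*`, `𝔭 ∤ ∞` (the unit group of the ring of finite adèles). -/
abbrev IdeleGroup := InftyIdeles F K × (FiniteAdeleRing OK K)ˣ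

/-- The diagonal embedding `K^* → J_K`. -/
def diagonal : Kˣ →* IdeleGroup F K :=
  (MonoidHom.pi fun w : InftyPrime F K =>
      Units.map (algebraMap K (w.adicCompletion K)).toMonoidHom).prod
    (FiniteAdeleRing.unitEmbedding OK K)

/-- The subgroup `K^*` of `J_K`. -/
def principalIdeles : Subgroup (IdeleGroup F K) := (diagonal F K).range

/-- The group `∏_{𝔭 ∤ ∞} U_𝔭`, where `U_𝔭` is the group of units of `K_𝔭`. -/
def finiteUnits : Subgroup (FiniteAdeleRing OK K)ˣ where
  carrier := {α | ∀ v : HeightOneSpectrum OK, Valued.v (α.1 v) = 1}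
  one_mem' v := map_one (Valued.v (R := v.adicCompletion K))
  mul_mem' {α β} hα hβ v :=
    (map_mul (Valued.v (R := v.adicCompletion K)) (α.1 v) (β.1 v)).trans (by
      rw [hα v, hβ v, one_mul])
  inv_mem' {α} hα v := by
    have h : (α.1 v) * (α⁻¹.1 v) = 1 :=
      congrArg (fun a : FiniteAdeleRing OK K => a v) α.mul_inv
    have h2 := congrArg (Valued.v (R := v.adicCompletion K)) h
    rw [map_mul, hα v, one_mul, map_one] at h2
    exact h2

/-- The subgroup `Δ × ∏_{𝔭 ∤ ∞} U_𝔭` of `J_K`. -/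
def DeltaUnits (n : ℕ) : Subgroup (IdeleGroup F K) := (Delta F K n).prod (finiteUnits F K)

/-- `J_K^{(+)}`, the group of idèles whose infinite components lie in `Δ`. -/
def IdelesPlus (n : ℕ) : Subgroup (IdeleGroup F K) :=
  (Delta F K n).comap (MonoidHom.fst (InftyIdeles F K) (FiniteAdeleRing OK K)ˣ)

/-- `K^{(+)} = K^* ∩ J_K^{(+)}`, as a subgroup of `J_K`. -/
def KPlus (n : ℕ) : Subgroup (IdeleGroup F K) := principalIdeles F K ⊓ IdelesPlus F K n

/-! ### Ideals -/

/-- `I_K`, the group of (nonzero, equivalently invertible) fractional ideals of `𝒪_K`. -/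
abbrev IdealGroup := (FractionalIdeal OK⁰ K)ˣ

/-- `P_K^{(+)}`, the group of principal fractional ideals `⟨β⟩` with `β ∈ K^{(+)}`. -/
def PrincipalPlus (n : ℕ) : Subgroup (IdealGroup F K) :=
  ((IdelesPlus F K n).comap (diagonal F K)).map (toPrincipalIdeal OK K)

/-- The narrow-type class group `Cl(𝒪_K)^{(+)} = I_K / P_K^{(+)}`. -/
abbrev ClassGroupPlus (n : ℕ) := IdealGroup F K ⧸ PrincipalPlus F K n

variable {F K}

/-- A finite prime of `K` as an element of `I_K`. -/
def primeIdeal (v : HeightOneSpectrum OK) : IdealGroup F K :=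
  Units.mk0 (v.asIdeal : FractionalIdeal OK⁰ K) (FractionalIdeal.coeIdeal_ne_zero.2 v.ne_bot)

/-- The additive normalized valuation `v_𝔭(α_𝔭)` of an idèle at a finite prime `𝔭`. -/
def ideleOrd (α : IdeleGroup F K) (v : HeightOneSpectrum OK) : ℤ :=
  -WithZero.log (Valued.v (α.2.1 v))

/-- Almost all components of an idèle are units. -/
theorem finite_ideleOrd_ne_zero (α : IdeleGroup F K) :
    {v : HeightOneSpectrum OK | ideleOrd α v ≠ 0}.Finite := by
  have h := (FiniteAdeleRing.isUnit_iff.1 α.2.isUnit).2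
  refine (Filter.eventually_cofinite.1 h).subset fun v hv h1 => hv ?_
  rw [ideleOrd, h1, WithZero.log_one, neg_zero]

/-- The ideal `∏_{𝔭 ∤ ∞} 𝔭 ^ v_𝔭(α_𝔭)` of an idèle `α` (a product with finitely many factors
different from `1`). -/
def ideleIdeal (α : IdeleGroup F K) : IdealGroup F K :=
  ∏ᶠ v : HeightOneSpectrum OK, primeIdeal v ^ ideleOrd α v

end KummerIdeles

end

open IsDedekindDomain Filter Topology WithZero

/-! The heart is the equality $J_K = K^* J_K^{(+)}$. Weak approximation gives $\beta \in K^*$ such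
that $\beta\alpha$ is a 1-unit at every infinite prime (`exists_valuation_mul_sub_one_lt`). Since $n
\mid q-1$ is prime to the characteristic, every 1-unit of $K_{\mathfrak p}$ is an $n$-th power, so
the product of the norms is one too and $\beta\alpha \in J_K^{(+)}$.

The first isomorphism is then the second isomorphism theorem. Its kernel is found by the modular
law, because $\Delta \times \prod U_{\mathfrak p} \subseteq J_K^{(+)}$.

The second comes from `ideleIdealHom`. It is surjective already on idèles with trivial infinite
part, its kernel on $J_K$ consists of the idèles that are units at all finite primes, and it sends a
principal idèle to its principal ideal. -/

/-! ### Roots of 1-units in characteristic $p$ -/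

theorem Valued.exists_pow_eq_of_valuation_sub_one_lt {L : Type*} [Field L] [Valued L ℤᵐ⁰]
    [CompleteSpace L] [T2Space L] (p f n : ℕ) [Fact p.Prime] [CharP L p] (hf : f ≠ 0)
    (hn : n ∣ p ^ f - 1) {u : L} (hu : Valued.v (u - 1) < 1) : ∃ y, y ^ n = u := by
  obtain ⟨d, hd⟩ := hn
  have hq1 : 1 < p ^ f := Nat.one_lt_pow hf (Fact.out : p.Prime).one_lt
  have hn0 : n ≠ 0 := by rintro rfl; omega
  have hu1 : Valued.v u = 1 := by
    have := Valuation.map_one_add_of_lt _ hu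
    rwa [add_sub_cancel] at this
  have hu0 : u ≠ 0 := by rintro rfl; simp at hu1
  have hfrob : ∀ (x : L) (m : ℕ), x ^ (p ^ f) ^ m - 1 = (x - 1) ^ (p ^ f) ^ m := fun x m => by
    rw [← pow_mul, sub_pow_char_pow, one_pow]
  have hpow : ∀ x : L, Valued.v (x - 1) < 1 →
      Tendsto (fun m : ℕ => (x - 1) ^ (p ^ f) ^ m) atTop (𝓝 0) := fun x hx =>
    (Valued.tendsto_zero_pow_of_v_lt_one hx).comp (tendsto_pow_atTop_atTop_of_one_lt hq1)
  have hc : Valued.v (u ^ d - 1) < 1 := by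
    rw [← mul_geom_sum, map_mul]
    refine mul_lt_one_of_lt_of_le hu (Valuation.map_sum_le _ fun i _ => ?_)
    rw [map_pow, hu1, one_pow]
  -- With $q = p^f$ and $nd = q-1$, the exponent of $u$ in $y_m^n$ is $(q-1)(1 + q + \dots +
  -- q^{m-1}) = q^m - 1$. Hence $y_m^n u = u^{q^m} \to 1$, and the inverse of $\lim y_m$ is the
  -- desired root.
  let y : ℕ → L := fun m => (u ^ d) ^ (∑ i ∈ Finset.range m, (p ^ f) ^ i)
  have hy1 : ∀ m, Valued.v (y m) = 1 := fun m => by simp [y, hu1]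
  have hstep : ∀ m, y (m + 1) - y m = y m * (u ^ d - 1) ^ (p ^ f) ^ m := fun m => by
    rw [← hfrob]
    simp only [y, Finset.sum_range_succ, pow_add]
    ring
  have hyn : ∀ m, y m ^ n * u = u ^ (p ^ f) ^ m := fun m => by
    have hsum := geom_sum_mul_add (p ^ f - 1) m
    rw [Nat.sub_add_cancel hq1.le] at hsum
    rw [← hsum, hd, pow_succ, ← pow_mul, ← pow_mul]
    ring_nf
  have hna : NonarchimedeanAddGroup L := ⟨fun U hU => by
    obtain ⟨γ, hγ⟩ := Valued.mem_nhds_zero.1 hU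
    exact ⟨⟨Valued.v.restrict.ltAddSubgroup γ, Valued.isOpen_ball L γ.1⟩, hγ⟩⟩
  -- In a nonarchimedean group it is enough that successive differences tend to $0$. By Frobenius
  -- they are $y_m (u^d - 1)^{q^m}$ with $|y_m| = 1$ and $|u^d - 1| < 1$.
  have hcauchy : CauchySeq y := by
    refine NonarchimedeanAddGroup.cauchySeq_of_tendsto_sub_nhds_zero (tendsto_def.2 fun s hs => ?_)
    obtain ⟨γ, hγ⟩ := Valued.mem_nhds_zero.1 hs
    have hev : ∀ᶠ m in atTop, Valued.v.restrict ((u ^ d - 1) ^ (p ^ f) ^ m) < γ :=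
      hpow _ hc (Valued.mem_nhds_zero.2 ⟨γ, subset_rfl⟩)
    filter_upwards [hev] with m hm
    refine hγ ?_
    change Valued.v.restrict (y (m + 1) - y m) < γ
    have hy1' : Valued.v.restrict (y m) = 1 := by simpa using hy1 m
    rw [hstep, map_mul, hy1', one_mul]
    exact hm
  obtain ⟨z, hz⟩ := cauchySeq_tendsto_of_complete hcauchy
  have hone : Tendsto (fun m => y m ^ n * u) atTop (𝓝 1) := by
    have h := (hpow u hu).add_const 1
    simp only [← hfrob, sub_add_cancel, zero_add] at h
    simpa only [hyn] using h
  have key := tendsto_nhds_unique ((hz.pow n).mul_const u) hone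
  exact ⟨z⁻¹, by rw [inv_pow, inv_eq_of_mul_eq_one_right key]⟩

/-! ### Approximation and prescribed valuations -/

namespace IsDedekindDomain

variable {R : Type*} [CommRing R] [IsDedekindDomain R] {K : Type*} [Field K] [Algebra R K]
  [IsFractionRing R K]

/-- Clear a common denominator $b$ and apply the Chinese remainder theorem to the numerators.
Dividing by $b$ afterwards is why the congruences must hold to precision $\gamma_w |b|_w$. -/
theorem HeightOneSpectrum.exists_forall_valuation_sub_lt [Finite (HeightOneSpectrum R)]
    (x : HeightOneSpectrum R → K) (γ : HeightOneSpectrum R → ℤᵐ⁰) (hγ : ∀ w, γ w ≠ 0) :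
    ∃ β : K, ∀ w : HeightOneSpectrum R, w.valuation K (β - x w) < γ w := by
  cases nonempty_fintype (HeightOneSpectrum R)
  obtain ⟨b, hb⟩ := IsLocalization.exist_integer_multiples_of_finite R⁰ x
  choose a ha using hb
  have hb0 : algebraMap R K b ≠ 0 := by simp
  have hN : ∀ w : HeightOneSpectrum R, ∃ N : ℕ,
      exp (-(N : ℤ)) < γ w * w.valuation K (algebraMap R K b) := by
    intro w
    have h0 : γ w * w.valuation K (algebraMap R K b) ≠ 0 :=
      mul_ne_zero (hγ w) (by simp)
    rw [← exp_log h0]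
    refine ⟨(1 - log (γ w * w.valuation K (algebraMap R K b))).toNat, ?_⟩
    rw [exp_lt_exp]
    omega
  choose N hN using hN
  obtain ⟨r, hr⟩ := IsDedekindDomain.exists_forall_sub_mem_ideal (s := Finset.univ)
    (fun w : HeightOneSpectrum R => w.asIdeal) N (fun w _ => w.prime)
    (fun w _ w' _ h h' => h (HeightOneSpectrum.ext h')) (fun w => a w)
  refine ⟨algebraMap R K r / algebraMap R K b, fun w => ?_⟩
  have h1 : algebraMap R K r / algebraMap R K b - x w =
      algebraMap R K (r - a w) / algebraMap R K b := by
    rw [map_sub, ha w, Algebra.smul_def]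
    field_simp
  rw [h1, map_div₀, div_lt_iff₀ (by simp [zero_lt_iff])]
  refine lt_of_le_of_lt ?_ (hN w)
  rw [HeightOneSpectrum.valuation_of_algebraMap, HeightOneSpectrum.intValuation_le_pow_iff_mem]
  exact hr w (Finset.mem_univ _)

theorem HeightOneSpectrum.exists_valuation_sub_lt (w : HeightOneSpectrum R)
    (a : w.adicCompletion K) {γ : ℤᵐ⁰} (hγ : γ ≠ 0) :
    ∃ x : K, Valued.v (algebraMap K (w.adicCompletion K) x - a) < γ := by
  obtain ⟨c, hc⟩ := w.valuedAdicCompletion_surjective K γ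
  have hc0 : c ≠ 0 := by rintro rfl; simp at hc; exact hγ hc.symm
  have hopen : {y : w.adicCompletion K | Valued.v (y - a) < γ} ∈ 𝓝 a := by
    rw [Valued.mem_nhds]
    refine ⟨Units.mk0 (Valued.v.restrict c) (by simpa using hc0), fun y hy => ?_⟩
    have := (Valuation.restrict_lt_iff _).1 hy
    rwa [hc] at this
  obtain ⟨x, hx⟩ := (HeightOneSpectrum.denseRange_algebraMap (R := R) (K := K) w).exists_mem_open
    isOpen_interior ⟨a, mem_interior_iff_mem_nhds.2 hopen⟩
  have hx' := interior_subset hx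
  exact ⟨x, hx'⟩

theorem FiniteAdeleRing.exists_units_valuation_eq (e : HeightOneSpectrum R → ℤ)
    (he : ∀ᶠ v in cofinite, e v = 0) :
    ∃ a : (FiniteAdeleRing R K)ˣ, ∀ v, Valued.v (a.1 v) = exp (e v) := by
  choose a ha using fun v : HeightOneSpectrum R =>
    v.valuedAdicCompletion_surjective K (exp (e v))
  let b : FiniteAdeleRing R K := ⟨a, by
    filter_upwards [he] with v hv
    change Valued.v (a v) ≤ 1
    rw [ha, hv, exp_zero]⟩
  have hb : IsUnit b := FiniteAdeleRing.isUnit_iff.2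
    ⟨fun v h => by
      have h1 : Valued.v (a v) = 0 := (Valuation.zero_iff _).2 h
      rw [ha] at h1
      exact exp_ne_zero h1,
    by
      filter_upwards [he] with v hv
      exact (ha v).trans (by rw [hv, exp_zero])⟩
  exact ⟨hb.unit, ha⟩

end IsDedekindDomain

/-! ### Exponents of principal fractional ideals -/

namespace FractionalIdeal

variable {R : Type*} [CommRing R] [IsDedekindDomain R] {K : Type*} [Field K] [Algebra R K]
  [IsFractionRing R K]

theorem count_spanSingleton_algebraMap (v : HeightOneSpectrum R) {r : R} (hr : r ≠ 0) :
    count K v (spanSingleton R⁰ (algebraMap R K r)) = -log (v.valuation K (algebraMap R K r)) := by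
  classical
  rw [← coeIdeal_span_singleton, count_coe K v (by simpa using hr),
    HeightOneSpectrum.valuation_of_algebraMap, HeightOneSpectrum.intValuation_if_neg _ hr, log_exp,
    neg_neg]

theorem count_spanSingleton (v : HeightOneSpectrum R) {x : K} (hx : x ≠ 0) :
    count K v (spanSingleton R⁰ x) = -log (v.valuation K x) := by
  obtain ⟨r, s, hs, rfl⟩ := IsFractionRing.div_surjective (A := R) x
  have hs0 : s ≠ 0 := nonZeroDivisors.ne_zero hs
  have hr0 : r ≠ 0 := by rintro rfl; simp at hx
  have hsK : algebraMap R K s ≠ 0 := by simpa using hs0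
  have hrK : algebraMap R K r ≠ 0 := by simpa using hr0
  -- Additivity applied to $\langle r/s\rangle\langle s\rangle = \langle r\rangle$ reduces to the
  -- integral case.
  have h := count_mul K v (I := spanSingleton R⁰ (algebraMap R K r / algebraMap R K s))
    (I' := spanSingleton R⁰ (algebraMap R K s)) (by simp [spanSingleton_eq_zero_iff, hr0, hs0])
    (by simp [spanSingleton_eq_zero_iff, hs0])
  rw [spanSingleton_mul_spanSingleton, div_mul_cancel₀ _ hsK, count_spanSingleton_algebraMap v hr0,
    count_spanSingleton_algebraMap v hs0] at h
  rw [map_div₀, log_div (by simpa using hrK) (by simpa using hsK)]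
  omega

end FractionalIdeal

/-! ### The infinite components -/

namespace KummerIdeles

variable {F K : Type*} [Field F] [DecidableEq (RatFunc F)] [Field K] [Algebra (RatFunc F) K]
  [FiniteDimensional (RatFunc F) K] [Algebra.IsSeparable (RatFunc F) K]

/-- Norms are multiplicative, so the product of the norms of the roots is a root of the product of
the norms. -/
theorem mem_Delta_of_pow {n : ℕ} {α : InftyIdeles F K} (h : ∀ w, ∃ y, y ^ n = (α w).1)
    (hn : n ≠ 0) : α ∈ Delta F K n := by
  choose y hy using h
  have hy0 : ∀ w, y w ≠ 0 := fun w h0 => (α w).ne_zero (by rw [← hy, h0, zero_pow hn])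
  refine ⟨inftyNorm F K fun w => Units.mk0 (y w) (hy0 w), ?_⟩
  rw [powMonoidHom_apply, ← map_pow]
  congr 1
  ext w
  simp [hy]

theorem InftyPrime.exists_pow_eq [Finite F] (w : InftyPrime F K) {n : ℕ}
    (hn : n ∣ Nat.card F - 1) {u : w.adicCompletion K} (hu : Valued.v (u - 1) < 1) :
    ∃ y, y ^ n = u := by
  cases nonempty_fintype F
  obtain ⟨p, hp⟩ := CharP.exists F
  obtain ⟨f, hpp, hf⟩ := FiniteField.card F p
  have := Fact.mk hpp
  have : CharP (w.adicCompletion K) p :=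
    charP_of_injective_ringHom ((algebraMap K (w.adicCompletion K)).comp
      ((algebraMap (RatFunc F) K).comp (algebraMap F (RatFunc F)))).injective p
  exact Valued.exists_pow_eq_of_valuation_sub_one_lt p f n f.ne_zero
    (by rwa [Nat.card_eq_fintype_card, hf] at hn) hu

/-- Up to multiplication by an element of `K^*`, every element of `∏_{𝔭 ∣ ∞} K_𝔭^*` is close to `1`. -/
theorem exists_valuation_mul_sub_one_lt (α : InftyIdeles F K) :
    ∃ β : Kˣ, ∀ w : InftyPrime F K,
      Valued.v (algebraMap K (w.adicCompletion K) β * (α w).1 - 1) < 1 := by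
  -- That $\beta \ne 0$ is read off at some infinite prime, where $\beta = 0$ would give $|-1| < 1$.
  cases isEmpty_or_nonempty (InftyPrime F K) with
  | inl h => exact ⟨1, fun w => h.elim w⟩
  | inr h =>
    -- Approximating $\alpha_w^{-1}$ with error below $|\alpha_w^{-1}|$ makes the error of
    -- $\beta\alpha_w$ against $1$ less than $1$. Density gives local approximants $x_w \in K$,
    -- which one global $\beta$ then approximates simultaneously.
    have hγ : ∀ w : InftyPrime F K, Valued.v ((α w)⁻¹).1 ≠ 0 := fun w => by simp
    choose x hx using fun w : InftyPrime F K => w.exists_valuation_sub_lt ((α w)⁻¹).1 (hγ w)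
    obtain ⟨β, hβ⟩ := HeightOneSpectrum.exists_forall_valuation_sub_lt x _ hγ
    have hβ' : ∀ w : InftyPrime F K,
        Valued.v (algebraMap K (w.adicCompletion K) β * (α w).1 - 1) < 1 := by
      intro w
      have h1 : Valued.v (algebraMap K (w.adicCompletion K) (β - x w)) < Valued.v ((α w)⁻¹).1 :=
        (w.valuedAdicCompletion_eq_valuation' _).trans_lt (hβ w)
      have h2 := Valuation.map_add_lt _ h1 (hx w)
      rw [map_sub, sub_add_sub_cancel] at h2
      have h3 : algebraMap K (w.adicCompletion K) β * (α w).1 - 1 =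
          (algebraMap K (w.adicCompletion K) β - ((α w)⁻¹).1) * (α w).1 := by
        rw [sub_mul, Units.inv_mul]
      rw [h3, map_mul]
      refine (mul_lt_mul_of_pos_right h2 (by simp [zero_lt_iff])).trans_eq ?_
      rw [← map_mul, Units.inv_mul, map_one]
    refine ⟨Units.mk0 β ?_, hβ'⟩
    rintro rfl
    obtain ⟨w⟩ := h
    simpa using hβ' w

/-! ### From idèles to ideals -/

variable [Algebra F[X] K] [IsScalarTower F[X] (RatFunc F) K]

local notation "OK" => FunctionField.ringOfIntegers F K

theorem DeltaUnits_le_IdelesPlus (n : ℕ) : DeltaUnits F K n ≤ IdelesPlus F K n := fun _ h => h.1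

theorem exists_diagonal_mul_mem_IdelesPlus [Finite F] {n : ℕ} (hn0 : n ≠ 0)
    (hn : n ∣ Nat.card F - 1) (α : IdeleGroup F K) :
    ∃ β : Kˣ, diagonal F K β * α ∈ IdelesPlus F K n := by
  obtain ⟨β, hβ⟩ := exists_valuation_mul_sub_one_lt α.1
  exact ⟨β, mem_Delta_of_pow (fun w => w.exists_pow_eq hn (hβ w)) hn0⟩

theorem ideleOrd_mul (α β : IdeleGroup F K) (v : HeightOneSpectrum OK) :
    ideleOrd (α * β) v = ideleOrd α v + ideleOrd β v := by
  have hne : ∀ a : IdeleGroup F K, Valued.v (a.2.1 v) ≠ 0 := fun a =>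
    (Valuation.ne_zero_iff _).2 ((FiniteAdeleRing.isUnit_iff.1 a.2.isUnit).1 v)
  have h : (α * β).2.1 v = α.2.1 v * β.2.1 v := rfl
  rw [ideleOrd, h, map_mul, log_mul (hne α) (hne β), neg_add]
  rfl

theorem ideleOrd_eq_zero_iff (α : IdeleGroup F K) (v : HeightOneSpectrum OK) :
    ideleOrd α v = 0 ↔ Valued.v (α.2.1 v) = 1 := by
  have hne : Valued.v (α.2.1 v) ≠ 0 :=
    (Valuation.ne_zero_iff _).2 ((FiniteAdeleRing.isUnit_iff.1 α.2.isUnit).1 v)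
  rw [ideleOrd, neg_eq_zero]
  refine ⟨fun h => ?_, fun h => by rw [h, log_one]⟩
  rw [← exp_log hne, h, exp_zero]

theorem ideleOrd_diagonal (β : Kˣ) (v : HeightOneSpectrum OK) :
    ideleOrd (diagonal F K β) v = -log (v.valuation K β.1) :=
  congrArg (fun a => -log a) (v.valuedAdicCompletion_eq_valuation' β.1)

theorem coe_ideleIdeal (α : IdeleGroup F K) :
    (ideleIdeal α : FractionalIdeal OK⁰ K) =
      ∏ᶠ v : HeightOneSpectrum OK, (v.asIdeal : FractionalIdeal OK⁰ K) ^ ideleOrd α v := by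
  have hfin : (Function.mulSupport fun v : HeightOneSpectrum OK =>
      primeIdeal v ^ ideleOrd α v).Finite :=
    (finite_ideleOrd_ne_zero α).subset fun v hv h => hv (by simp [h])
  refine ((Units.coeHom (FractionalIdeal OK⁰ K)).map_finprod hfin).trans ?_
  exact finprod_congr fun v => by
    rw [Units.coeHom_apply, Units.val_zpow_eq_zpow_val]; rfl

theorem count_ideleIdeal (α : IdeleGroup F K) (v : HeightOneSpectrum OK) :
    FractionalIdeal.count K v (ideleIdeal α : FractionalIdeal OK⁰ K) = ideleOrd α v := by
  rw [coe_ideleIdeal]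
  exact FractionalIdeal.count_finprod K v _ (eventually_cofinite.2 (finite_ideleOrd_ne_zero α))

/-- Unique factorization: identities in $I_K$ can be checked on exponents, one prime at a time. -/
theorem ideleIdeal_eq_iff {α : IdeleGroup F K} {I : IdealGroup F K} :
    ideleIdeal α = I ↔
      ∀ v : HeightOneSpectrum OK, ideleOrd α v = FractionalIdeal.count K v I.1 := by
  refine ⟨fun h v => by rw [← h, count_ideleIdeal], fun h => Units.ext ?_⟩
  rw [coe_ideleIdeal, ← FractionalIdeal.finprod_heightOneSpectrum_factorization' K I.ne_zero]
  exact finprod_congr fun v => by rw [h v]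

variable (F K) in
/-- The homomorphism `J_K → I_K`, `α ↦ ∏_{𝔭 ∤ ∞} 𝔭 ^ v_𝔭(α_𝔭)`. -/
noncomputable def ideleIdealHom : IdeleGroup F K →* IdealGroup F K :=
  MonoidHom.mk' ideleIdeal fun α β => ideleIdeal_eq_iff.2 fun v => by
    rw [Units.val_mul, FractionalIdeal.count_mul K v (Units.ne_zero _) (Units.ne_zero _),
      count_ideleIdeal, count_ideleIdeal, ideleOrd_mul]

theorem ideleIdealHom_diagonal (β : Kˣ) :
    ideleIdealHom F K (diagonal F K β) = toPrincipalIdeal OK K β :=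
  ideleIdeal_eq_iff.2 fun v => by
    rw [ideleOrd_diagonal, coe_toPrincipalIdeal, FractionalIdeal.count_spanSingleton v β.ne_zero]

theorem ideleIdealHom_eq_one_iff {α : IdeleGroup F K} :
    ideleIdealHom F K α = 1 ↔ α.2 ∈ finiteUnits F K := by
  refine ideleIdeal_eq_iff.trans (forall_congr' fun v => ?_)
  rw [Units.val_one, FractionalIdeal.count_one, ideleOrd_eq_zero_iff]

theorem exists_mem_IdelesPlus_ideleIdeal_eq (n : ℕ) (I : IdealGroup F K) :
    ∃ α ∈ IdelesPlus F K n, ideleIdealHom F K α = I := by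
  obtain ⟨a, ha⟩ := FiniteAdeleRing.exists_units_valuation_eq (K := K)
    (fun v : HeightOneSpectrum OK => -FractionalIdeal.count K v I.1)
    ((FractionalIdeal.finite_factors I.1).mono fun v hv => by rw [hv, neg_zero])
  -- The condition $\Delta$ restricts only the infinite part, so taking that part trivial leaves the
  -- finite part free.
  refine ⟨(1, a), one_mem (Delta F K n), ideleIdeal_eq_iff.2 fun v => ?_⟩
  change -log (Valued.v (a.1 v)) = _
  rw [ha, log_exp, neg_neg]

/-- If $\alpha$ and $\beta \in K^{(+)}$ have the same ideal, then $\beta^{-1}\alpha$ is a unit at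
all finite primes, and its infinite part stays in the group $\Delta$. -/
theorem ideleIdealHom_mem_PrincipalPlus_iff {n : ℕ} {α : IdeleGroup F K}
    (hα : α ∈ IdelesPlus F K n) :
    ideleIdealHom F K α ∈ PrincipalPlus F K n ↔ α ∈ KPlus F K n ⊔ DeltaUnits F K n := by
  rw [Subgroup.mem_sup]
  constructor
  · rintro ⟨β, hβ, h⟩
    refine ⟨diagonal F K β, ⟨⟨β, rfl⟩, hβ⟩, (diagonal F K β)⁻¹ * α, ⟨?_, ?_⟩, by simp⟩
    · exact (IdelesPlus F K n).mul_mem ((IdelesPlus F K n).inv_mem hβ) hα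
    · apply ideleIdealHom_eq_one_iff.1
      rw [map_mul, map_inv, ideleIdealHom_diagonal, h, inv_mul_cancel]
  · rintro ⟨_, ⟨⟨β, rfl⟩, hβ⟩, δ, hδ, rfl⟩
    rw [map_mul, ideleIdealHom_eq_one_iff.2 hδ.2, mul_one, ideleIdealHom_diagonal]
    exact ⟨β, hβ, rfl⟩

/-- This is the modular law; it computes the kernel of $J_K^{(+)} \to J_K / K^*(\Delta \times \prod
U_{\mathfrak p})$. -/
theorem principalIdeles_sup_DeltaUnits_inf_IdelesPlus (n : ℕ) :
    (principalIdeles F K ⊔ DeltaUnits F K n) ⊓ IdelesPlus F K n =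
      KPlus F K n ⊔ DeltaUnits F K n := by
  rw [KPlus, sup_comm, sup_inf_assoc_of_le _ (DeltaUnits_le_IdelesPlus n), sup_comm]

/-! ### The two isomorphisms -/

variable (F K) in
/-- The isomorphism `J_K^{(+)} / K^{(+)}(Δ × ∏ U_𝔭) ≃ J_K / K^*(Δ × ∏ U_𝔭)` induced by the
inclusion. -/
noncomputable def idelesPlusQuotientEquiv [Finite F] {n : ℕ} (hn0 : n ≠ 0)
    (hn : n ∣ Nat.card F - 1) :
    IdelesPlus F K n ⧸ (KPlus F K n ⊔ DeltaUnits F K n).subgroupOf (IdelesPlus F K n) ≃*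
      IdeleGroup F K ⧸ (principalIdeles F K ⊔ DeltaUnits F K n) := by
  let φ := (QuotientGroup.mk' (principalIdeles F K ⊔ DeltaUnits F K n)).comp
    (IdelesPlus F K n).subtype
  have hφ : Function.Surjective φ := fun x => by
    obtain ⟨α, rfl⟩ := QuotientGroup.mk_surjective x
    obtain ⟨β, hβ⟩ := exists_diagonal_mul_mem_IdelesPlus hn0 hn α
    -- The classes of $\beta\alpha$ and $\alpha$ agree because $(\beta\alpha)^{-1}\alpha =
    -- \beta^{-1}$ is principal.
    refine ⟨⟨_, hβ⟩, QuotientGroup.eq.2 (Subgroup.mem_sup_left ⟨β⁻¹, ?_⟩)⟩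
    simp
  refine (QuotientGroup.quotientMulEquivOfEq ?_).trans
    (QuotientGroup.quotientKerEquivOfSurjective φ hφ)
  ext α
  rw [Subgroup.mem_subgroupOf, ← principalIdeles_sup_DeltaUnits_inf_IdelesPlus, MonoidHom.mem_ker]
  refine Iff.trans ?_ (QuotientGroup.eq_one_iff (α : IdeleGroup F K)).symm
  exact and_iff_left α.2

theorem idelesPlusQuotientEquiv_mk [Finite F] {n : ℕ} (hn0 : n ≠ 0) (hn : n ∣ Nat.card F - 1)
    (α : IdelesPlus F K n) :
    idelesPlusQuotientEquiv F K hn0 hn (QuotientGroup.mk α) =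
      QuotientGroup.mk (α : IdeleGroup F K) := rfl

variable (F K) in
/-- The isomorphism `J_K^{(+)} / K^{(+)}(Δ × ∏ U_𝔭) ≃ Cl(𝒪_K)^{(+)}` induced by
`α ↦ ∏_{𝔭 ∤ ∞} 𝔭 ^ v_𝔭(α_𝔭)`. -/
noncomputable def idelesPlusQuotientEquivClassGroupPlus (n : ℕ) :
    IdelesPlus F K n ⧸ (KPlus F K n ⊔ DeltaUnits F K n).subgroupOf (IdelesPlus F K n) ≃*
      ClassGroupPlus F K n := by
  let φ := ((QuotientGroup.mk' (PrincipalPlus F K n)).comp (ideleIdealHom F K)).comp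
    (IdelesPlus F K n).subtype
  have hφ : Function.Surjective φ := fun x => by
    obtain ⟨I, rfl⟩ := QuotientGroup.mk_surjective x
    obtain ⟨α, hα, rfl⟩ := exists_mem_IdelesPlus_ideleIdeal_eq n I
    exact ⟨⟨α, hα⟩, rfl⟩
  refine (QuotientGroup.quotientMulEquivOfEq ?_).trans
    (QuotientGroup.quotientKerEquivOfSurjective φ hφ)
  ext α
  rw [Subgroup.mem_subgroupOf, ← ideleIdealHom_mem_PrincipalPlus_iff α.2, MonoidHom.mem_ker]
  exact (QuotientGroup.eq_one_iff (ideleIdealHom F K (α : IdeleGroup F K))).symm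

theorem idelesPlusQuotientEquivClassGroupPlus_mk (n : ℕ) (α : IdelesPlus F K n) :
    idelesPlusQuotientEquivClassGroupPlus F K n (QuotientGroup.mk α) =
      QuotientGroup.mk (ideleIdeal (α : IdeleGroup F K)) := rfl

end KummerIdeles

theorem proposition2p8 (F : Type*) [Field F] [Finite F] [DecidableEq (RatFunc F)]
    (K : Type*) [Field K] [Algebra (RatFunc F) K] [Algebra F[X] K]
    [IsScalarTower F[X] (RatFunc F) K] [FiniteDimensional (RatFunc F) K]
    [IsAbelianGalois (RatFunc F) K]
    (n : ℕ) (hn : Monoid.exponent (K ≃ₐ[RatFunc F] K) = n) (hnq : n ∣ Nat.card F - 1) :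
    ∃ (e₁ : KummerIdeles.IdeleGroup F K ⧸
          (KummerIdeles.principalIdeles F K ⊔ KummerIdeles.DeltaUnits F K n) ≃*
        KummerIdeles.IdelesPlus F K n ⧸
          (KummerIdeles.KPlus F K n ⊔ KummerIdeles.DeltaUnits F K n).subgroupOf
            (KummerIdeles.IdelesPlus F K n))
      (e₂ : KummerIdeles.IdelesPlus F K n ⧸
          (KummerIdeles.KPlus F K n ⊔ KummerIdeles.DeltaUnits F K n).subgroupOf
            (KummerIdeles.IdelesPlus F K n) ≃*
        KummerIdeles.ClassGroupPlus F K n),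
      (∀ α : KummerIdeles.IdelesPlus F K n,
        e₁ (QuotientGroup.mk (α : KummerIdeles.IdeleGroup F K)) = QuotientGroup.mk α) ∧
      (∀ α : KummerIdeles.IdelesPlus F K n,
        e₂ (QuotientGroup.mk α) =
          QuotientGroup.mk (KummerIdeles.ideleIdeal (α : KummerIdeles.IdeleGroup F K))) := by
  have hn0 : n ≠ 0 := hn ▸ Monoid.exponent_ne_zero_of_finite
  exact ⟨(KummerIdeles.idelesPlusQuotientEquiv F K hn0 hnq).symm,
    KummerIdeles.idelesPlusQuotientEquivClassGroupPlus F K n,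
    fun α => (MulEquiv.symm_apply_eq _).2
      (KummerIdeles.idelesPlusQuotientEquiv_mk hn0 hnq α).symm,
    KummerIdeles.idelesPlusQuotientEquivClassGroupPlus_mk n⟩
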